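/- Let $n\ge 1$, $d=2^n$, and let $\rho$ be an $n$-qubit state, i.e. a positive semidefinite $d\times d$ complex matrix of trace $1$, written in the computational basis. Let $\mathcal I$ be the set of incoherent (diagonal) states, and let $$C_g(\rho)=1-\max_{\sigma\in\mathcal I}F(\rho,\sigma),\qquad F(\rho,\sigma)=\|\sqrt{\rho}\,\sqrt{\sigma}\|_1^2,$$ be the geometric measure of coherence, where $\|M\|_1=\operatorname{tr}\sqrt{M^\dagger M}$. For probability vectors $p,q\in\mathbb R^d$, $p$ is majorized by $q$ if, for every $k\le d$, the sum of the $k$ largest entries of $p$ is at most the sum of the $k$ largest entries of $q$. The majorization meet $\bigwedge_{p\in X}p$ of a nonempty set $X$ of probability vectors is its greatest lower bound, and the join $p\vee q$ is the least upper bound, among probability vectors ordered by majorization; both exist and are unique up to a permutation of the entries. Let $S_L(p)=1-\sum_{i=1}^d p_i^2$. Let $\boldsymbol d=(\rho_{11},\dots,\rho_{dd})$, let $\{|\psi_k\rangle\}_{k=1}^{d}$ be an orthonormal basis of $\mathbb C^d$, and let $X$ be any set of probability vectors in $\mathbb R^d$ that contains the true measurement distribution $(\langle\psi_k|\rho|\psi_k\rangle)_{k=1}^{d}$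 (for example, the set of all probability vectors that satisfy a system of linear constraints $Ap\ge\alpha$, $Bp=\beta$ satisfied by the true distribution). Put $$l_{C_{l_2}}(\rho)=S_L(\boldsymbol d)-S_L\Bigl(\boldsymbol d\vee\bigl(\textstyle\bigwedge_{p\in X}p\bigr)\Bigr).$$ Then $1-\frac{d}{d-1}\,l_{C_{l_2}}(\rho)\ge 0$ and $$C_g(\rho)\ \ge\ l_{C_g}(\rho)=\frac{d-1}{d}\left(1-\sqrt{1-\frac{d}{d-1}\,l_{C_{l_2}}(\rho)}\right).$$ -/

import Mathlib

namespace CoherenceEstimation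

/-! ### Majorization of finite vectors -/

/-- The decreasing rearrangement `p↓` of a vector `p`. -/
noncomputable def decr {d : ℕ} (p : Fin d → ℝ) : Fin d → ℝ :=
  fun i => p (Tuple.sort p i.rev)

/-- The sum of the `k` largest entries of `p` (the Lorenz curve of `p` at `k`). -/
noncomputable def lorenz {d : ℕ} (p : Fin d → ℝ) (k : ℕ) : ℝ :=
  ∑ i : Fin d with i.val < k, decr p i

/-- `p ≺ q`: the vector `p` is majorized by `q`. -/
def Majorized {d : ℕ} (p q : Fin d → ℝ) : Prop :=
  (∀ k ≤ d, lorenz p k ≤ lorenz q k) ∧ ∑ i, p i = ∑ i, q i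

/-- `m` is a majorization meet of the set `X`: a greatest lower bound of `X` for majorization among
probability vectors.  It is unique up to a permutation of its entries. -/
def IsMajMeet {d : ℕ} (X : Set (Fin d → ℝ)) (m : Fin d → ℝ) : Prop :=
  m ∈ stdSimplex ℝ (Fin d) ∧ (∀ p ∈ X, Majorized m p) ∧
    ∀ r ∈ stdSimplex ℝ (Fin d), (∀ p ∈ X, Majorized r p) → Majorized r m

/-- `m` is a majorization join of `p` and `q`: a least upper bound for majorization among
probability vectors.  It is unique up to a permutation of its entries. -/
def IsMajJoin {d : ℕ} (p q m : Fin d → ℝ) : Prop :=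
  m ∈ stdSimplex ℝ (Fin d) ∧ (Majorized p m ∧ Majorized q m) ∧
    ∀ r ∈ stdSimplex ℝ (Fin d), Majorized p r → Majorized q r → Majorized m r

/-- The majorization meet of a nonempty set of probability vectors, with decreasing entries: its
Lorenz curve is the pointwise infimum of the Lorenz curves of the members.
See `isMajMeet_majMeet`. -/
noncomputable def majMeet {d : ℕ} (X : Set (Fin d → ℝ)) : Fin d → ℝ :=
  fun i => (⨅ p : X, lorenz p.1 (i.val + 1)) - ⨅ p : X, lorenz p.1 i.val

/-- The majorization join of two probability vectors, with decreasing entries: the meet of all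
their common upper bounds.  See `isMajJoin_majJoin`. -/
noncomputable def majJoin {d : ℕ} (p q : Fin d → ℝ) : Fin d → ℝ :=
  majMeet {r | r ∈ stdSimplex ℝ (Fin d) ∧ Majorized p r ∧ Majorized q r}

theorem antitone_decr {d : ℕ} (p : Fin d → ℝ) : Antitone (decr p) := fun _ _ h =>
  Tuple.monotone_sort p (Fin.rev_le_rev.mpr h)

theorem sum_decr {d : ℕ} (p : Fin d → ℝ) : ∑ i, decr p i = ∑ i, p i :=
  Equiv.sum_comp (Fin.revPerm.trans (Tuple.sort p)) p

theorem decr_of_antitone {d : ℕ} {p : Fin d → ℝ} (hp : Antitone p) : decr p = p := by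
  have h1 : Monotone (p ∘ Tuple.sort p) := Tuple.monotone_sort p
  have h2 : Monotone (p ∘ (Fin.revPerm : Equiv.Perm (Fin d))) := fun _ _ h =>
    hp (Fin.rev_le_rev.mpr h)
  have h3 := Tuple.unique_monotone h1 h2
  funext i
  have := congrFun h3 i.rev
  simpa [decr] using this

theorem lorenz_zero {d : ℕ} (p : Fin d → ℝ) : lorenz p 0 = 0 := by simp [lorenz]

theorem lorenz_succ {d : ℕ} (p : Fin d → ℝ) (i : Fin d) :
    lorenz p (i.val + 1) = lorenz p i.val + decr p i := by
  have : (Finset.univ.filter fun j : Fin d => j.val < i.val + 1)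
      = insert i (Finset.univ.filter fun j : Fin d => j.val < i.val) := by
    ext j; simp [Fin.ext_iff]; omega
  rw [lorenz, this, Finset.sum_insert (by simp), lorenz, add_comm]

theorem lorenz_full {d : ℕ} (p : Fin d → ℝ) : lorenz p d = ∑ i, p i := by
  rw [← sum_decr p, lorenz]
  congr 1
  ext j; simp

theorem lorenz_mono {d : ℕ} {p : Fin d → ℝ} (hp : p ∈ stdSimplex ℝ (Fin d)) :
    Monotone (lorenz p) := fun _ _ h =>
  Finset.sum_le_sum_of_subset_of_nonneg
    (fun j hj => by simp at hj ⊢; omega) (fun _ _ _ => hp.1 _)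

theorem lorenz_nonneg {d : ℕ} {p : Fin d → ℝ} (hp : p ∈ stdSimplex ℝ (Fin d)) (k : ℕ) :
    0 ≤ lorenz p k := Finset.sum_nonneg fun _ _ => hp.1 _

/-- `majMeet X` is indeed a majorization meet of `X`. -/
theorem isMajMeet_majMeet {d : ℕ} {X : Set (Fin d → ℝ)} (hne : X.Nonempty)
    (hX : X ⊆ stdSimplex ℝ (Fin d)) : IsMajMeet X (majMeet X) := by
  have : Nonempty X := hne.to_subtype
  set L : ℕ → ℝ := fun k => ⨅ p : X, lorenz p.1 k with hL
  have hbdd (k : ℕ) : BddBelow (Set.range fun p : X => lorenz p.1 k) :=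
    ⟨0, by rintro _ ⟨p, rfl⟩; exact lorenz_nonneg (hX p.2) k⟩
  have hLle (p : X) (k : ℕ) : L k ≤ lorenz p.1 k := ciInf_le (hbdd k) p
  have hLmono : Monotone L := fun a b h => le_ciInf fun p =>
    (hLle p a).trans (lorenz_mono (hX p.2) h)
  have hL0 : L 0 = 0 := by simp [hL, lorenz_zero]
  have hLd : L d = 1 := by
    have : ∀ p : X, lorenz p.1 d = 1 := fun p => by rw [lorenz_full]; exact (hX p.2).2
    simp [hL, this]
  have hm (i : Fin d) : majMeet X i = L (i.val + 1) - L i.val := rfl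
  have hstep (k : ℕ) (hk : k + 1 < d) : L (k + 1 + 1) - L (k + 1) ≤ L (k + 1) - L k := by
    have : (L (k + 1 + 1) + L k) / 2 ≤ L (k + 1) := le_ciInf fun p => by
      have h1 := lorenz_succ p.1 ⟨k, by omega⟩
      have h2 := lorenz_succ p.1 ⟨k + 1, hk⟩
      have h3 := antitone_decr p.1 (show (⟨k, by omega⟩ : Fin d) ≤ ⟨k + 1, hk⟩ from by simp)
      have h4 := hLle p (k + 1 + 1)
      have h5 := hLle p k
      simp only at h1 h2
      linarith
    linarith
  have hanti : Antitone (majMeet X) := by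
    intro i j hij
    obtain ⟨i, hi⟩ := i
    obtain ⟨j, hj⟩ := j
    have hij' : i ≤ j := hij
    clear hij
    induction j, hij' using Nat.le_induction with
    | base => exact le_rfl
    | succ j hij ih =>
      refine le_trans ?_ (ih (by omega))
      rw [hm, hm]
      exact hstep j hj
  have hlor (k : ℕ) (hk : k ≤ d) : lorenz (majMeet X) k = L k := by
    induction k with
    | zero => rw [lorenz_zero, hL0]
    | succ k ih =>
      have := lorenz_succ (majMeet X) ⟨k, by omega⟩
      simp only at this
      rw [this, ih (by omega), decr_of_antitone hanti, hm]
      simp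
  have hsum : ∑ i, majMeet X i = 1 := by rw [← lorenz_full, hlor d le_rfl, hLd]
  refine ⟨⟨fun i => ?_, hsum⟩, fun p hp => ⟨fun k hk => ?_, ?_⟩, fun r hr h => ⟨fun k hk => ?_, ?_⟩⟩
  · rw [hm]; linarith [hLmono (Nat.le_succ i.val)]
  · rw [hlor k hk]; exact hLle ⟨p, hp⟩ k
  · rw [hsum, (hX hp).2]
  · rw [hlor k hk]; exact le_ciInf fun p => (h p.1 p.2).1 k hk
  · rw [hsum, hr.2]

/-- The point mass at the first index majorizes every probability vector. -/
theorem majorized_single {d : ℕ} (hd : 0 < d) {r : Fin d → ℝ} (hr : r ∈ stdSimplex ℝ (Fin d)) :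
    Majorized r (Pi.single ⟨0, hd⟩ 1) := by
  have hs : (Pi.single ⟨0, hd⟩ 1 : Fin d → ℝ) ∈ stdSimplex ℝ (Fin d) :=
    single_mem_stdSimplex ℝ (⟨0, hd⟩ : Fin d)
  have hanti : Antitone (Pi.single ⟨0, hd⟩ 1 : Fin d → ℝ) := by
    intro i j hij
    by_cases hj : j = ⟨0, hd⟩
    · have : i = ⟨0, hd⟩ := by
        subst hj
        exact Fin.ext (Nat.le_zero.mp hij)
      rw [hj, this]
    · rw [Pi.single_eq_of_ne hj]; exact hs.1 i
  refine ⟨fun k hk => ?_, by rw [hr.2, hs.2]⟩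
  rcases k with _ | k
  · rw [lorenz_zero, lorenz_zero]
  · have h1 : lorenz r (k + 1) ≤ 1 := by
      rw [← hr.2, ← lorenz_full]; exact lorenz_mono hr hk
    have h2 : lorenz (Pi.single ⟨0, hd⟩ 1 : Fin d → ℝ) (0 + 1) = 1 := by
      have := lorenz_succ (Pi.single ⟨0, hd⟩ 1 : Fin d → ℝ) ⟨0, hd⟩
      rw [decr_of_antitone hanti, Pi.single_eq_same] at this
      simp only [lorenz_zero] at this
      linarith
    calc lorenz r (k + 1) ≤ 1 := h1
      _ = lorenz (Pi.single ⟨0, hd⟩ 1 : Fin d → ℝ) (0 + 1) := h2.symm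
      _ ≤ _ := lorenz_mono hs (by omega)

/-- `majJoin p q` is indeed a majorization join of `p` and `q`. -/
theorem isMajJoin_majJoin {d : ℕ} {p q : Fin d → ℝ} (hp : p ∈ stdSimplex ℝ (Fin d))
    (hq : q ∈ stdSimplex ℝ (Fin d)) : IsMajJoin p q (majJoin p q) := by
  have hd : 0 < d := by
    rcases Nat.eq_zero_or_pos d with rfl | h
    · have := hp.2; simp at this
    · exact h
  have hne : {r | r ∈ stdSimplex ℝ (Fin d) ∧ Majorized p r ∧ Majorized q r}.Nonempty :=
    ⟨Pi.single ⟨0, hd⟩ 1, single_mem_stdSimplex ℝ (⟨0, hd⟩ : Fin d),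
      majorized_single hd hp, majorized_single hd hq⟩
  obtain ⟨h1, h2, h3⟩ := isMajMeet_majMeet hne fun r hr => hr.1
  refine ⟨h1, ⟨h3 p hp fun r hr => hr.2.1, h3 q hq fun r hr => hr.2.2⟩, fun r hr hpr hqr => ?_⟩
  exact h2 r ⟨hr, hpr, hqr⟩

/-- The linear (Tsallis-2) entropy of a probability vector. -/
def linearEntropy {d : ℕ} (p : Fin d → ℝ) : ℝ := 1 - ∑ i, p i ^ 2

/-! ### States, measurements and coherence -/

section
open scoped ComplexOrder MatrixOrder Matrix

/-- A quantum state (density matrix). -/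
def IsState {d : ℕ} (ρ : Matrix (Fin d) (Fin d) ℂ) : Prop :=
  ρ.PosSemidef ∧ ρ.trace = 1

/-- An incoherent state: a state that is diagonal in the computational basis. -/
def IsIncoherent {d : ℕ} (σ : Matrix (Fin d) (Fin d) ℂ) : Prop :=
  IsState σ ∧ σ.IsDiag

/-- The trace norm `‖M‖₁ = tr √(Mᴴ M)`. -/
noncomputable def traceNorm {d : ℕ} (M : Matrix (Fin d) (Fin d) ℂ) : ℝ :=
  (CFC.sqrt (Mᴴ * M)).trace.re

/-- The fidelity `F(ρ, σ) = ‖√ρ √σ‖₁²`. -/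
noncomputable def fidelity {d : ℕ} (ρ σ : Matrix (Fin d) (Fin d) ℂ) : ℝ :=
  traceNorm (CFC.sqrt ρ * CFC.sqrt σ) ^ 2

/-- The geometric measure of coherence `C_g(ρ) = 1 - max_{σ incoherent} F(ρ, σ)`.
The maximum is attained, see `isGreatest_fidelity`. -/
noncomputable def geometricCoherence {d : ℕ} (ρ : Matrix (Fin d) (Fin d) ℂ) : ℝ :=
  1 - sSup {F | ∃ σ, IsIncoherent σ ∧ F = fidelity ρ σ}

/-- The probability distribution of the outcomes when `ρ` is measured in the orthonormal basis
`ψ`, with `k`-th entry `⟨ψ_k|ρ|ψ_k⟩`. -/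
noncomputable def measDist {d : ℕ} (ψ : OrthonormalBasis (Fin d) ℂ (EuclideanSpace ℂ (Fin d)))
    (ρ : Matrix (Fin d) (Fin d) ℂ) : Fin d → ℝ :=
  fun k => (star (ψ k).ofLp ⬝ᵥ ρ *ᵥ (ψ k).ofLp).re

/-- The vector of diagonal entries of `ρ` (which are real for a state). -/
def diagDist {d : ℕ} (ρ : Matrix (Fin d) (Fin d) ℂ) : Fin d → ℝ := fun i => (ρ i i).re

/-- The estimate `l_{C_{l_2}} = S_L(𝐝) - S_L(𝐝 ∨ ⋀_{p ∈ X} p)` obtained from the diagonal `𝐝` of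
`ρ` and the set `X` of feasible measurement distributions. -/
noncomputable def l2Estimate {d : ℕ} (ρ : Matrix (Fin d) (Fin d) ℂ) (X : Set (Fin d → ℝ)) : ℝ :=
  linearEntropy (diagDist ρ) - linearEntropy (majJoin (diagDist ρ) (majMeet X))

open scoped Matrix.Norms.L2Operator in
/-- The maximum in the definition of `geometricCoherence` is attained. -/
theorem isGreatest_fidelity {d : ℕ} (hd : 0 < d) (ρ : Matrix (Fin d) (Fin d) ℂ) :
    IsGreatest {F | ∃ σ, IsIncoherent σ ∧ F = fidelity ρ σ} (1 - geometricCoherence ρ) := by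
  have himg : {F | ∃ σ, IsIncoherent σ ∧ F = fidelity ρ σ} =
      (fun s : Fin d → ℝ => fidelity ρ (Matrix.diagonal fun i => (s i : ℂ))) ''
        stdSimplex ℝ (Fin d) := by
    ext F
    constructor
    · rintro ⟨σ, ⟨⟨h1, h2⟩, h3⟩, rfl⟩
      have hre : ∀ i, (((σ i i).re : ℝ) : ℂ) = σ i i := fun i => by
        have := (Complex.nonneg_iff.mp (h1.diag_nonneg (i := i))).2
        exact Complex.ext (by simp) (by simpa using this)
      refine ⟨fun i => (σ i i).re,
        ⟨fun i => (Complex.nonneg_iff.mp (h1.diag_nonneg (i := i))).1, ?_⟩, ?_⟩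
      · have := congrArg Complex.re h2
        simpa [Matrix.trace] using this
      · simp only [hre]
        congr 1
        ext i j
        by_cases hij : i = j
        · subst hij; simp
        · rw [Matrix.diagonal_apply_ne _ hij, h3 hij]
    · rintro ⟨s, hs, rfl⟩
      refine ⟨_, ⟨⟨Matrix.PosSemidef.diagonal fun i => ?_, ?_⟩, Matrix.isDiag_diagonal _⟩, rfl⟩
      · simpa using hs.1 i
      · rw [Matrix.trace_diagonal]; exact_mod_cast hs.2
  have hcont : ContinuousOn
      (fun s : Fin d → ℝ => fidelity ρ (Matrix.diagonal fun i => (s i : ℂ)))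
      (stdSimplex ℝ (Fin d)) := by
    have hdiag : Continuous fun s : Fin d → ℝ =>
        (Matrix.diagonal fun i => (s i : ℂ) : Matrix (Fin d) (Fin d) ℂ) :=
      Continuous.matrix_diagonal (by fun_prop)
    have h1 : ContinuousOn (fun s : Fin d → ℝ =>
        CFC.sqrt (Matrix.diagonal fun i => (s i : ℂ) : Matrix (Fin d) (Fin d) ℂ))
        (stdSimplex ℝ (Fin d)) :=
      CFC.continuousOn_sqrt.comp hdiag.continuousOn fun s hs =>
        (Matrix.PosSemidef.diagonal fun i => by simpa using hs.1 i).nonneg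
    have h2 : Continuous fun M : Matrix (Fin d) (Fin d) ℂ => CFC.sqrt (Mᴴ * M) :=
      CFC.continuousOn_sqrt.comp_continuous
        (continuous_id.matrix_conjTranspose.matrix_mul continuous_id)
        fun M => (Matrix.posSemidef_conjTranspose_mul_self M).nonneg
    have h3 : Continuous fun M : Matrix (Fin d) (Fin d) ℂ => traceNorm M :=
      Complex.continuous_re.comp h2.matrix_trace
    exact (h3.comp_continuousOn (continuousOn_const.mul h1)).pow 2
  have hcomp := (isCompact_stdSimplex ℝ (Fin d)).image_of_continuousOn hcont
  have hne : (stdSimplex ℝ (Fin d)).Nonempty := ⟨_, single_mem_stdSimplex ℝ ⟨0, hd⟩⟩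
  rw [geometricCoherence, sub_sub_cancel, himg]
  exact hcomp.isGreatest_sSup (hne.image _)

end

end CoherenceEstimation

namespace CoherenceEstimation

/-! ### Properties of majorization -/

/-! Write `p` for the diagonal of `ρ`, `s` for that of an incoherent `σ`, and `C = tr ρ² - ∑ pᵢ²`.

Fidelity is bounded by superfidelity, `F(ρ, σ) ≤ tr ρσ + √(1 - tr ρ²) √(1 - tr σ²)`
(`fidelity_le_superfidelity`). The reason is that `(tr N)² - tr N²`, for `N = |√ρ √σ|`, is twice the
trace of the second exterior power of `N`. That power factors through those of `U√ρ` and `√σ` for a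
unitary `U`, so Cauchy–Schwarz applies.

For diagonal `σ` the bound involves only `p`, `s` and `tr ρ²`. Centring `p` and `s` at the uniform
vector and appending the coordinates `√(1 - tr ρ²)` and `√(1 - ∑ sᵢ²)` turns it into `1/d` plus an
inner product. The vector built from `s` has squared length `1 - 1/d` whatever `s` is, and the one
built from `ρ` has `1 - 1/d - C`. Hence every fidelity is at most `1/d + √(1 - 1/d) √(1 - 1/d - C)`
(`sum_mul_add_sqrt_mul_sqrt_le`).

This decreases in `C`, so a lower bound for `C` suffices. The spectrum majorizes both the diagonal
and the true distribution, hence also the join, and Schur-convexity of the sum of squares gives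
`l2Estimate ρ X ≤ C` (`l2Estimate_le`). -/

theorem lorenz_eq_sum_ite {d : ℕ} (p : Fin d → ℝ) (k : ℕ) :
    lorenz p k = ∑ i : Fin d, (if i.val < k then 1 else 0) * decr p i := by
  simp [lorenz, Finset.sum_filter]

/-- A weighted sum with weights in `[0, 1]` of total `k` is at most the sum of the `k` largest
entries. -/
theorem sum_mul_le_lorenz {d k : ℕ} (hk : k ≤ d) (c p : Fin d → ℝ) (h0 : ∀ i, 0 ≤ c i)
    (h1 : ∀ i, c i ≤ 1) (hc : ∑ i, c i = k) : ∑ i, c i * p i ≤ lorenz p k := by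
  set e : Equiv.Perm (Fin d) := Fin.revPerm.trans (Tuple.sort p)
  have he (i : Fin d) : p (e i) = decr p i := rfl
  rw [← Equiv.sum_comp e fun i => c i * p i, lorenz_eq_sum_ite]
  rw [← Equiv.sum_comp e] at hc
  have hcard : ∑ i : Fin d, (if i.val < k then (1 : ℝ) else 0) = k := by
    rw [Fin.sum_univ_eq_sum_range (fun i => if i < k then (1 : ℝ) else 0) d,
      ← Finset.sum_filter]
    have : (Finset.range d).filter (· < k) = Finset.range k := by ext; simp; omega
    simp [this]
  -- A threshold `τ` separates the `k` largest entries from the rest. Subtracting it costs nothing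
  -- because both weight vectors have total `k`, and then every term of the difference has the right
  -- sign.
  obtain ⟨τ, hτ1, hτ2⟩ : ∃ τ, (∀ i : Fin d, i.val < k → τ ≤ decr p i) ∧
      ∀ i : Fin d, k ≤ i.val → decr p i ≤ τ := by
    rcases Nat.lt_or_ge k d with h | h
    · exact ⟨decr p ⟨k, h⟩, fun i hi => antitone_decr p (Fin.mk_le_mk.mpr hi.le),
        fun i hi => antitone_decr p (Fin.mk_le_mk.mpr hi)⟩
    · rcases Nat.eq_zero_or_pos d with rfl | hd
      · exact ⟨0, fun i => i.elim0, fun i => i.elim0⟩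
      · exact ⟨decr p ⟨d - 1, by omega⟩, fun i _ => antitone_decr p (by
          rw [Fin.le_def]; simp only; omega), fun i hi => by omega⟩
  have key : ∑ i, (c (e i) - if i.val < k then 1 else 0) * (decr p i - τ) ≤ 0 := by
    refine Finset.sum_nonpos fun i _ => ?_
    split_ifs with h
    · exact mul_nonpos_of_nonpos_of_nonneg (by linarith [h1 (e i)]) (by linarith [hτ1 i h])
    · exact mul_nonpos_of_nonneg_of_nonpos (by linarith [h0 (e i)])
        (by linarith [hτ2 i (not_lt.mp h)])
  have expand : ∑ i, (c (e i) - if i.val < k then 1 else 0) * (decr p i - τ) =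
      ∑ i, c (e i) * decr p i - ∑ i : Fin d, (if i.val < k then 1 else 0) * decr p i
        - (∑ i, c (e i) - ∑ i : Fin d, (if i.val < k then (1 : ℝ) else 0)) * τ := by
    rw [← Finset.sum_sub_distrib, ← Finset.sum_sub_distrib, Finset.sum_mul,
      ← Finset.sum_sub_distrib]
    exact Finset.sum_congr rfl fun i _ => by ring
  rw [expand, hc, hcard] at key
  simp only [he]
  linarith

/-- The image of a vector under a doubly stochastic matrix is majorized by that vector. -/
theorem majorized_of_doublyStochastic {d : ℕ} {W : Fin d → Fin d → ℝ} (h0 : ∀ i j, 0 ≤ W i j)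
    (hrow : ∀ i, ∑ j, W i j = 1) (hcol : ∀ j, ∑ i, W i j = 1) {p q : Fin d → ℝ}
    (hp : ∀ i, p i = ∑ j, W i j * q j) : Majorized p q := by
  constructor
  · intro k hk
    set e : Equiv.Perm (Fin d) := Fin.revPerm.trans (Tuple.sort p)
    -- The weight of `q j` is a partial column sum of `W`, hence at most `1`; the weights total `k`
    -- because `k` rows are used.
    have : lorenz p k = ∑ j, (∑ i : Fin d with i.val < k, W (e i) j) * q j := by
      simp only [Finset.sum_mul]
      rw [Finset.sum_comm]
      exact Finset.sum_congr rfl fun i _ => hp (e i)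
    rw [this]
    refine sum_mul_le_lorenz hk _ _ (fun j => Finset.sum_nonneg fun i _ => h0 _ _)
      (fun j => ?_) ?_
    · rw [← hcol j, ← Equiv.sum_comp e fun i => W i j]
      exact Finset.sum_le_sum_of_subset_of_nonneg (Finset.subset_univ _) fun i _ _ => h0 _ _
    · rw [Finset.sum_comm]
      simp only [hrow, Finset.sum_const, nsmul_eq_mul, mul_one]
      rw [Fin.card_filter_val_lt, min_eq_right hk]
  · simp only [hp]
    rw [Finset.sum_comm]
    simp only [← Finset.sum_mul, hcol, one_mul]

theorem Majorized.trans {d : ℕ} {p q r : Fin d → ℝ} (h1 : Majorized p q) (h2 : Majorized q r) :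
    Majorized p r :=
  ⟨fun k hk => (h1.1 k hk).trans (h2.1 k hk), h1.2.trans h2.2⟩

/-- Summation by parts: a sum against an antitone sequence is nonnegative if the partial sums are
nonnegative and the total vanishes. -/
theorem sum_antitone_mul_nonneg {n : ℕ} (a g : ℕ → ℝ)
    (ha : ∀ i, i + 1 < n → a (i + 1) ≤ a i) (hg : ∀ k ≤ n, 0 ≤ ∑ i ∈ Finset.range k, g i)
    (h0 : ∑ i ∈ Finset.range n, g i = 0) : 0 ≤ ∑ i ∈ Finset.range n, a i * g i := by
  have h := Finset.sum_range_by_parts a g n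
  simp only [smul_eq_mul] at h
  rw [h, h0, mul_zero, zero_sub, neg_nonneg]
  refine Finset.sum_nonpos fun i hi => ?_
  have hi' := Finset.mem_range.mp hi
  exact mul_nonpos_of_nonpos_of_nonneg (by linarith [ha i (by omega)]) (hg _ (by omega))

theorem sum_sq_decr {d : ℕ} (p : Fin d → ℝ) : ∑ i, decr p i ^ 2 = ∑ i, p i ^ 2 :=
  Equiv.sum_comp (Fin.revPerm.trans (Tuple.sort p)) fun i => p i ^ 2

/-- The sum of squares is Schur-convex. -/
theorem Majorized.sum_sq_le {d : ℕ} {p q : Fin d → ℝ} (h : Majorized p q) :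
    ∑ i, p i ^ 2 ≤ ∑ i, q i ^ 2 := by
  rw [← sum_sq_decr p, ← sum_sq_decr q]
  set a : ℕ → ℝ := fun i => if h : i < d then decr p ⟨i, h⟩ else 0 with ha
  set b : ℕ → ℝ := fun i => if h : i < d then decr q ⟨i, h⟩ else 0 with hb
  have hsum (r : Fin d → ℝ) (k : ℕ) (hk : k ≤ d) :
      ∑ i ∈ Finset.range k, (if h : i < d then decr r ⟨i, h⟩ else 0) = lorenz r k := by
    induction k with
    | zero => simp [lorenz_zero]
    | succ k ih =>
      rw [Finset.sum_range_succ, ih (by omega), dif_pos (by omega)]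
      exact (lorenz_succ r ⟨k, by omega⟩).symm
  -- By `q² - p² = 2p(q - p) + (q - p)²` it is enough that `∑ p(q - p) ≥ 0` for the decreasing
  -- rearrangements. The partial sums of `q - p` are gaps between Lorenz curves.
  have key := sum_antitone_mul_nonneg (n := d) a (fun i => b i - a i)
    (fun i hi => by
      simp only [ha, dif_pos hi, dif_pos (show i < d by omega)]
      exact antitone_decr p (Fin.mk_le_mk.mpr (Nat.le_succ i)))
    (fun k hk => by
      rw [Finset.sum_sub_distrib, hsum q k hk, hsum p k hk]
      linarith [h.1 k hk])
    (by
      rw [Finset.sum_sub_distrib, hsum q d le_rfl, hsum p d le_rfl, lorenz_full, lorenz_full, h.2,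
        sub_self])
  rw [← Fin.sum_univ_eq_sum_range (fun i => a i * (b i - a i))] at key
  have ha' (i : Fin d) : a i = decr p i := by simp [ha]
  have hb' (i : Fin d) : b i = decr q i := by simp [hb]
  simp only [ha', hb'] at key
  have : ∑ i, decr q i ^ 2 - ∑ i, decr p i ^ 2 = 2 * ∑ i, decr p i * (decr q i - decr p i)
      + ∑ i, (decr q i - decr p i) ^ 2 := by
    rw [Finset.mul_sum, ← Finset.sum_sub_distrib, ← Finset.sum_add_distrib]
    exact Finset.sum_congr rfl fun i _ => by ring
  have hsq : 0 ≤ ∑ i, (decr q i - decr p i) ^ 2 := Finset.sum_nonneg fun _ _ => sq_nonneg _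
  linarith

end CoherenceEstimation

namespace CoherenceEstimation

/-! ### The superfidelity bound -/

section
open scoped ComplexOrder MatrixOrder Matrix
open Matrix

/-- Square matrices with the same absolute value differ by a unitary factor. -/
theorem exists_unitary_mul_eq {d : ℕ} {A B : Matrix (Fin d) (Fin d) ℂ} (h : Aᴴ * A = Bᴴ * B) :
    ∃ U : Matrix (Fin d) (Fin d) ℂ, Uᴴ * U = 1 ∧ U * A = B := by
  set E := EuclideanSpace ℂ (Fin d)
  set f : E →ₗ[ℂ] E := toEuclideanLin A with hf
  set g : E →ₗ[ℂ] E := toEuclideanLin B with hg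
  have hsq (M : Matrix (Fin d) (Fin d) ℂ) (x : E) :
      ((‖toEuclideanLin M x‖ ^ 2 : ℝ) : ℂ) = inner ℂ x (toEuclideanLin (Mᴴ * M) x) := by
    rw [toLpLin_mul_same, LinearMap.comp_apply, toEuclideanLin_conjTranspose_eq_adjoint,
      LinearMap.adjoint_inner_right, inner_self_eq_norm_sq_to_K]
    simp
  have hnorm (x : E) : ‖f x‖ = ‖g x‖ := by
    have : ((‖f x‖ ^ 2 : ℝ) : ℂ) = ((‖g x‖ ^ 2 : ℝ) : ℂ) := by rw [hsq, hsq, h]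
    exact (sq_eq_sq₀ (norm_nonneg _) (norm_nonneg _)).mp (by exact_mod_cast this)
  have hker : LinearMap.ker f ≤ LinearMap.ker g := fun x hx => by
    rw [LinearMap.mem_ker] at hx ⊢
    rw [← norm_eq_zero, ← hnorm, hx, norm_zero]
  -- The map `Ax ↦ Bx` is well defined on the range of `A` since `ker A ≤ ker B`, and isometric
  -- since `‖Ax‖ = ‖Bx‖`. In finite dimension it extends to an isometry of the whole space.
  set L₀ : LinearMap.range f →ₗ[ℂ] E :=
    (LinearMap.ker f).liftQ g hker ∘ₗ f.quotKerEquivRange.symm.toLinearMap with hL₀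
  have hL₀_apply (x : E) : L₀ ⟨f x, x, rfl⟩ = g x := by
    have : f.quotKerEquivRange.symm ⟨f x, x, rfl⟩ = (LinearMap.ker f).mkQ x :=
      f.quotKerEquivRange_symm_apply_image x _
    simp [hL₀, this]
  set L : LinearMap.range f →ₗᵢ[ℂ] E := ⟨L₀, by
    rintro ⟨_, x, rfl⟩
    rw [hL₀_apply]
    exact (hnorm x).symm⟩
  set V := L.extend
  have hV (x : E) : V (f x) = g x := (L.extend_apply ⟨f x, x, rfl⟩).trans (hL₀_apply x)
  set U : Matrix (Fin d) (Fin d) ℂ := toEuclideanLin.symm V.toLinearMap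
  have hU : toEuclideanLin U = V.toLinearMap := LinearEquiv.apply_symm_apply _ _
  refine ⟨U, ?_, ?_⟩
  · apply toEuclideanLin.injective
    rw [toLpLin_mul_same, toEuclideanLin_conjTranspose_eq_adjoint, hU]
    ext1 x
    refine ext_inner_left ℂ fun y => ?_
    rw [LinearMap.comp_apply, LinearMap.adjoint_inner_right]
    simp
  · apply toEuclideanLin.injective
    rw [toLpLin_mul_same, hU]
    ext1 x
    exact hV x

/-- The Cauchy–Binet formula for `2 × 2` minors. -/
theorem two_mul_trace_sq_sub_trace_mul_self {ι R : Type*} [Fintype ι] [CommRing R]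
    (A B : Matrix ι ι R) :
    2 * ((A * B).trace ^ 2 - (A * B * (A * B)).trace) =
      ∑ x : (ι × ι) × ι × ι,
        (A x.1.1 x.2.1 * A x.1.2 x.2.2 - A x.1.1 x.2.2 * A x.1.2 x.2.1) *
        (B x.2.1 x.1.1 * B x.2.2 x.1.2 - B x.2.1 x.1.2 * B x.2.2 x.1.1) := by
  have h1 : (A * B).trace ^ 2 =
      ∑ i, ∑ k, ∑ j, ∑ l, (A i j * B j i) * (A k l * B l k) := by
    simp only [sq, Matrix.trace, Matrix.diag, Matrix.mul_apply, Finset.sum_mul_sum]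
  have h2 : (A * B * (A * B)).trace =
      ∑ i, ∑ k, ∑ j, ∑ l, (A i j * B j k) * (A k l * B l i) := by
    simp only [Matrix.trace, Matrix.diag, Matrix.mul_apply, Finset.sum_mul_sum]
  -- Expanding a product of two minors gives four terms. Two of them are the summands above; the
  -- other two are the same with `j` and `l` exchanged.
  have h1' : (A * B).trace ^ 2 =
      ∑ i, ∑ k, ∑ j, ∑ l, (A i l * B l i) * (A k j * B j k) := by
    rw [h1]
    exact Finset.sum_congr rfl fun i _ => Finset.sum_congr rfl fun k _ => Finset.sum_comm
  have h2' : (A * B * (A * B)).trace =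
      ∑ i, ∑ k, ∑ j, ∑ l, (A i l * B l k) * (A k j * B j i) := by
    rw [h2]
    exact Finset.sum_congr rfl fun i _ => Finset.sum_congr rfl fun k _ => Finset.sum_comm
  rw [two_mul]
  nth_rewrite 1 [h1, h2]
  rw [h1', h2']
  simp only [Fintype.sum_prod_type, ← Finset.sum_sub_distrib, ← Finset.sum_add_distrib]
  refine Finset.sum_congr rfl fun i _ => Finset.sum_congr rfl fun k _ =>
    Finset.sum_congr rfl fun j _ => Finset.sum_congr rfl fun l _ => ?_
  ring

/-- The Cauchy–Schwarz inequality for second exterior powers. -/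
theorem norm_trace_sq_sub_le {ι : Type*} [Fintype ι] (A B : Matrix ι ι ℂ) :
    ‖(A * B).trace ^ 2 - (A * B * (A * B)).trace‖ ≤
      √((A * Aᴴ).trace ^ 2 - (A * Aᴴ * (A * Aᴴ)).trace).re *
        √((Bᴴ * B).trace ^ 2 - (Bᴴ * B * (Bᴴ * B)).trace).re := by
  set a : (ι × ι) × ι × ι → ℂ := fun x =>
    A x.1.1 x.2.1 * A x.1.2 x.2.2 - A x.1.1 x.2.2 * A x.1.2 x.2.1 with ha
  set b : (ι × ι) × ι × ι → ℂ := fun x =>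
    B x.2.1 x.1.1 * B x.2.2 x.1.2 - B x.2.1 x.1.2 * B x.2.2 x.1.1 with hb
  -- When the second factor is `Aᴴ`, its minors are the conjugates of those of `A`, so the sum
  -- becomes one of squared norms.
  have hA : 2 * ((A * Aᴴ).trace ^ 2 - (A * Aᴴ * (A * Aᴴ)).trace).re = ∑ x, ‖a x‖ ^ 2 := by
    have h : 2 * ((A * Aᴴ).trace ^ 2 - (A * Aᴴ * (A * Aᴴ)).trace) =
        ((∑ x, ‖a x‖ ^ 2 : ℝ) : ℂ) := by
      rw [two_mul_trace_sq_sub_trace_mul_self]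
      push_cast
      refine Finset.sum_congr rfl fun x _ => ?_
      rw [← Complex.mul_conj', ha]
      simp only [conjTranspose_apply, map_sub, map_mul, RCLike.star_def]
      ring
    have h' := congrArg Complex.re h
    rwa [Complex.ofReal_re, ← Complex.ofReal_ofNat, Complex.re_ofReal_mul] at h'
  have hB : 2 * ((Bᴴ * B).trace ^ 2 - (Bᴴ * B * (Bᴴ * B)).trace).re = ∑ x, ‖b x‖ ^ 2 := by
    have h : 2 * ((Bᴴ * B).trace ^ 2 - (Bᴴ * B * (Bᴴ * B)).trace) =
        ((∑ x, ‖b x‖ ^ 2 : ℝ) : ℂ) := by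
      rw [two_mul_trace_sq_sub_trace_mul_self]
      push_cast
      refine Finset.sum_congr rfl fun x _ => ?_
      rw [← Complex.mul_conj', hb]
      simp only [conjTranspose_apply, map_sub, map_mul, RCLike.star_def]
      ring
    have h' := congrArg Complex.re h
    rwa [Complex.ofReal_re, ← Complex.ofReal_ofNat, Complex.re_ofReal_mul] at h'
  have h2 : 2 * ‖(A * B).trace ^ 2 - (A * B * (A * B)).trace‖ ≤
      √(∑ x, ‖a x‖ ^ 2) * √(∑ x, ‖b x‖ ^ 2) := by
    calc 2 * ‖(A * B).trace ^ 2 - (A * B * (A * B)).trace‖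
        = ‖2 * ((A * B).trace ^ 2 - (A * B * (A * B)).trace)‖ := by simp
      _ = ‖∑ x, a x * b x‖ := by rw [two_mul_trace_sq_sub_trace_mul_self]
      _ ≤ ∑ x, ‖a x‖ * ‖b x‖ := (norm_sum_le _ _).trans_eq (by simp)
      _ ≤ _ := Real.sum_mul_le_sqrt_mul_sqrt _ _ _
  rw [← hA, ← hB, Real.sqrt_mul zero_le_two, Real.sqrt_mul zero_le_two, mul_mul_mul_comm,
    Real.mul_self_sqrt zero_le_two] at h2
  linarith

/-- The fidelity is at most the superfidelity. -/
theorem fidelity_le_superfidelity {d : ℕ} {ρ σ : Matrix (Fin d) (Fin d) ℂ} (hρ : IsState ρ)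
    (hσ : IsState σ) :
    fidelity ρ σ ≤ (ρ * σ).trace.re + √(1 - (ρ * ρ).trace.re) * √(1 - (σ * σ).trace.re) := by
  set P := CFC.sqrt ρ with hP
  set Q := CFC.sqrt σ with hQ
  have hPP : P * P = ρ := CFC.sqrt_mul_sqrt_self ρ hρ.1.nonneg
  have hQQ : Q * Q = σ := CFC.sqrt_mul_sqrt_self σ hσ.1.nonneg
  have hPH : Pᴴ = P := (nonneg_iff_posSemidef.mp (CFC.sqrt_nonneg ρ)).isHermitian
  have hQH : Qᴴ = Q := (nonneg_iff_posSemidef.mp (CFC.sqrt_nonneg σ)).isHermitian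
  set N := CFC.sqrt ((P * Q)ᴴ * (P * Q)) with hN
  have hNN : N * N = (P * Q)ᴴ * (P * Q) :=
    CFC.sqrt_mul_sqrt_self _ (posSemidef_conjTranspose_mul_self _).nonneg
  have hNpos : N.PosSemidef := nonneg_iff_posSemidef.mp (CFC.sqrt_nonneg _)
  -- Polar decomposition writes `N` as `(U P) Q`. The unitary disappears from the traces of `(U P)(U
  -- P)ᴴ = U ρ Uᴴ` and of its square.
  obtain ⟨U, hU, hUN⟩ := exists_unitary_mul_eq (A := P * Q) (B := N)
    (by rw [hNpos.isHermitian.eq, hNN])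
  have hNtr : N.trace = (N.trace.re : ℂ) := (Complex.eq_re_of_ofReal_le hNpos.trace_nonneg)
  have hAB : U * P * Q = N := by rw [Matrix.mul_assoc, hUN]
  have hAA : U * P * (U * P)ᴴ = U * ρ * Uᴴ := by
    rw [conjTranspose_mul, hPH, ← hPP]; simp only [Matrix.mul_assoc]
  have htr1 : (U * ρ * Uᴴ).trace = 1 := by
    rw [trace_mul_comm, ← Matrix.mul_assoc, hU, Matrix.one_mul, hρ.2]
  have htr2 : (U * ρ * Uᴴ * (U * ρ * Uᴴ)).trace = (ρ * ρ).trace := by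
    have : U * ρ * Uᴴ * (U * ρ * Uᴴ) = U * (ρ * (Uᴴ * U) * ρ * Uᴴ) := by
      simp only [Matrix.mul_assoc]
    rw [this, hU, trace_mul_comm, Matrix.mul_one, Matrix.mul_assoc, hU, Matrix.mul_one]
  have htr3 : (N * N).trace = (ρ * σ).trace := by
    rw [hNN, conjTranspose_mul, hPH, hQH, ← hPP, ← hQQ, Matrix.mul_assoc, trace_mul_comm]
    simp only [Matrix.mul_assoc]
  have key := norm_trace_sq_sub_le (U * P) Q
  rw [hAB, hAA, htr1, htr2, htr3, hQH, hQQ, hσ.2] at key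
  have hre := (Complex.re_le_norm _).trans key
  have hF : fidelity ρ σ = (N.trace ^ 2).re := by
    rw [hNtr, fidelity, traceNorm, ← Complex.ofReal_pow, Complex.ofReal_re]
  simp only [Complex.sub_re, one_pow, Complex.one_re] at hre
  rw [hF]
  linarith

end

end CoherenceEstimation

namespace CoherenceEstimation

/-! ### Spectra -/

section
open scoped ComplexOrder MatrixOrder Matrix
open Matrix

/-- Expand `ψ k` in the eigenbasis of `ρ`. The squared overlaps of two orthonormal bases form a
doubly stochastic matrix, which is what majorization by the spectrum needs. -/
theorem measDist_eq_sum_eigenvalues {d : ℕ} {ρ : Matrix (Fin d) (Fin d) ℂ} (hρ : ρ.IsHermitian)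
    (ψ : OrthonormalBasis (Fin d) ℂ (EuclideanSpace ℂ (Fin d))) (k : Fin d) :
    measDist ψ ρ k = ∑ j, ‖inner ℂ (hρ.eigenvectorBasis j) (ψ k)‖ ^ 2 * hρ.eigenvalues j := by
  set v := hρ.eigenvectorBasis
  have hv (j : Fin d) : toEuclideanLin ρ (v j) = (hρ.eigenvalues j : ℂ) • v j := by
    apply (WithLp.ofLp_injective 2)
    simpa [toLpLin_apply] using hρ.mulVec_eigenvectorBasis j
  have hsymm := isSymmetric_toEuclideanLin_iff.mpr hρ
  have h1 : star (ψ k).ofLp ⬝ᵥ ρ *ᵥ (ψ k).ofLp = inner ℂ (ψ k) (toEuclideanLin ρ (ψ k)) := by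
    rw [EuclideanSpace.inner_eq_star_dotProduct, dotProduct_comm]
    rfl
  have h2 : star (ψ k).ofLp ⬝ᵥ ρ *ᵥ (ψ k).ofLp =
      ((∑ j, ‖inner ℂ (v j) (ψ k)‖ ^ 2 * hρ.eigenvalues j : ℝ) : ℂ) := by
    rw [h1, ← v.sum_inner_mul_inner]
    push_cast
    refine Finset.sum_congr rfl fun j _ => ?_
    rw [← hsymm, hv, inner_smul_left, ← Complex.conj_mul', inner_conj_symm, Complex.conj_ofReal]
    ring
  rw [measDist, h2, Complex.ofReal_re]

/-- Every measurement distribution is majorized by the spectrum. -/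
theorem majorized_measDist_eigenvalues {d : ℕ} {ρ : Matrix (Fin d) (Fin d) ℂ}
    (hρ : ρ.IsHermitian) (ψ : OrthonormalBasis (Fin d) ℂ (EuclideanSpace ℂ (Fin d))) :
    Majorized (measDist ψ ρ) hρ.eigenvalues := by
  refine majorized_of_doublyStochastic
    (W := fun k j => ‖inner ℂ (hρ.eigenvectorBasis j) (ψ k)‖ ^ 2)
    (fun _ _ => sq_nonneg _) (fun k => ?_) (fun j => ?_) (measDist_eq_sum_eigenvalues hρ ψ)
  · rw [hρ.eigenvectorBasis.sum_sq_norm_inner_right, ψ.orthonormal.1, one_pow]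
  · rw [ψ.sum_sq_norm_inner_left, hρ.eigenvectorBasis.orthonormal.1, one_pow]

/-- Treats the diagonal as one more measurement distribution, so that its majorization by the
spectrum needs no separate argument. -/
theorem measDist_basisFun {d : ℕ} (ρ : Matrix (Fin d) (Fin d) ℂ) :
    measDist (EuclideanSpace.basisFun (Fin d) ℂ) ρ = diagDist ρ := by
  funext k
  simp [measDist, diagDist]

theorem IsState.eigenvalues_mem_stdSimplex {d : ℕ} {ρ : Matrix (Fin d) (Fin d) ℂ}
    (hρ : IsState ρ) : hρ.1.isHermitian.eigenvalues ∈ stdSimplex ℝ (Fin d) := by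
  refine ⟨hρ.1.eigenvalues_nonneg, ?_⟩
  have := hρ.1.isHermitian.trace_eq_sum_eigenvalues.symm.trans hρ.2
  simpa using congrArg Complex.re this

theorem IsState.diagDist_mem_stdSimplex {d : ℕ} {ρ : Matrix (Fin d) (Fin d) ℂ}
    (hρ : IsState ρ) : diagDist ρ ∈ stdSimplex ℝ (Fin d) := by
  refine ⟨fun i => (Complex.nonneg_iff.mp (hρ.1.diag_nonneg (i := i))).1, ?_⟩
  have := congrArg Complex.re hρ.2
  simpa [Matrix.trace, diagDist] using this

theorem trace_mul_self_eq_sum_eigenvalues_sq {d : ℕ} {ρ : Matrix (Fin d) (Fin d) ℂ}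
    (hρ : ρ.IsHermitian) : (ρ * ρ).trace.re = ∑ i, hρ.eigenvalues i ^ 2 := by
  have h : (ρ * ρ).trace = ((∑ i, hρ.eigenvalues i ^ 2 : ℝ) : ℂ) := by
    conv_lhs => rw [hρ.spectral_theorem, ← map_mul, diagonal_mul_diagonal,
      Unitary.conjStarAlgAut_apply, trace_mul_comm, ← Matrix.mul_assoc, Unitary.coe_star_mul_self,
      Matrix.one_mul, trace_diagonal]
    push_cast
    exact Finset.sum_congr rfl fun i _ => by simp [sq]
  rw [h, Complex.ofReal_re]

/-- The `l₂` estimate is at most the `l₂` coherence `tr ρ² - ∑ᵢ ρᵢᵢ²`. -/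
theorem l2Estimate_le {d : ℕ} {ρ : Matrix (Fin d) (Fin d) ℂ} (hρ : IsState ρ)
    (ψ : OrthonormalBasis (Fin d) ℂ (EuclideanSpace ℂ (Fin d)))
    {X : Set (Fin d → ℝ)} (hX : X ⊆ stdSimplex ℝ (Fin d)) (hp : measDist ψ ρ ∈ X) :
    l2Estimate ρ X ≤ (ρ * ρ).trace.re - ∑ i, diagDist ρ i ^ 2 := by
  obtain ⟨hm, hmX, -⟩ := isMajMeet_majMeet ⟨_, hp⟩ hX
  obtain ⟨-, -, hmin⟩ := isMajJoin_majJoin hρ.diagDist_mem_stdSimplex hm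
  -- The spectrum is a common upper bound: it majorizes the diagonal directly, and the meet through
  -- the true distribution, a member of `X`.
  have h := (hmin _ hρ.eigenvalues_mem_stdSimplex
    (measDist_basisFun ρ ▸ majorized_measDist_eigenvalues hρ.1.isHermitian _)
    ((hmX _ hp).trans (majorized_measDist_eigenvalues hρ.1.isHermitian ψ))).sum_sq_le
  rw [← trace_mul_self_eq_sum_eigenvalues_sq] at h
  simp only [l2Estimate, linearEntropy]
  linarith

theorem sum_sq_le_one_of_mem_stdSimplex {ι : Type*} [Fintype ι] {p : ι → ℝ}
    (hp : p ∈ stdSimplex ℝ ι) : ∑ i, p i ^ 2 ≤ 1 := by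
  rw [← hp.2]
  refine Finset.sum_le_sum fun i _ => ?_
  have h1 : p i ≤ 1 := hp.2 ▸ Finset.single_le_sum (fun j _ => hp.1 j) (Finset.mem_univ i)
  nlinarith [hp.1 i]

theorem IsState.trace_mul_self_le_one {d : ℕ} {ρ : Matrix (Fin d) (Fin d) ℂ} (hρ : IsState ρ) :
    (ρ * ρ).trace.re ≤ 1 := by
  rw [trace_mul_self_eq_sum_eigenvalues_sq hρ.1.isHermitian]
  exact sum_sq_le_one_of_mem_stdSimplex hρ.eigenvalues_mem_stdSimplex

/-- Only diagonal entries of `ρ` meet a diagonal `σ`. Taking `ρ = σ` also gives the purity of `σ`.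
-/
theorem trace_mul_diag_re {d : ℕ} {ρ σ : Matrix (Fin d) (Fin d) ℂ} (hσ : IsIncoherent σ) :
    (ρ * σ).trace.re = ∑ i, diagDist ρ i * diagDist σ i := by
  have him (i : Fin d) : (σ i i).im = 0 :=
    (Complex.nonneg_iff.mp (hσ.1.1.diag_nonneg (i := i))).2.symm
  simp only [Matrix.trace, Matrix.diag, Matrix.mul_apply, Complex.re_sum, diagDist]
  refine Finset.sum_congr rfl fun i _ => ?_
  rw [Finset.sum_eq_single i (fun j _ hj => by rw [hσ.2 hj]; simp) (by simp)]
  simp [Complex.mul_re, him]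

/-- Cauchy–Schwarz about the uniform distribution. -/
theorem sum_mul_add_sqrt_mul_sqrt_le {d : ℕ} (hd : 0 < d) {p s : Fin d → ℝ} (hp : ∑ i, p i = 1)
    (hs : ∑ i, s i = 1) {t : ℝ} (ht : t ≤ 1) (hs1 : ∑ i, s i ^ 2 ≤ 1) :
    ∑ i, p i * s i + √(1 - t) * √(1 - ∑ i, s i ^ 2) ≤
      1 / d + √(1 - 1 / d) * √(1 - 1 / d - (t - ∑ i, p i ^ 2)) := by
  have hd' : (d : ℝ) ≠ 0 := by positivity
  have hexp (p q : Fin d → ℝ) (hp : ∑ i, p i = 1) (hq : ∑ i, q i = 1) :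
      ∑ i, (p i - 1 / d) * (q i - 1 / d) = ∑ i, p i * q i - 1 / d := by
    have : ∑ i, (p i - 1 / d) * (q i - 1 / d) =
        ∑ i, p i * q i - (∑ i, p i) * (1 / d) - (∑ i, q i) * (1 / d)
          + ∑ _i : Fin d, (1 / d : ℝ) * (1 / d) := by
      rw [Finset.sum_mul, Finset.sum_mul, ← Finset.sum_sub_distrib, ← Finset.sum_sub_distrib,
        ← Finset.sum_add_distrib]
      exact Finset.sum_congr rfl fun i _ => by ring
    rw [this, hp, hq]
    simp only [Finset.sum_const, Finset.card_univ, Fintype.card_fin, nsmul_eq_mul]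
    field_simp
    ring
  set u := ∑ i, p i ^ 2 - 1 / d with hu
  set w := ∑ i, s i ^ 2 - 1 / d with hw
  have hu' : ∑ i, (p i - 1 / d) ^ 2 = u := by simpa only [hu, sq] using hexp p p hp hp
  have hw' : ∑ i, (s i - 1 / d) ^ 2 = w := by simpa only [hw, sq] using hexp s s hs hs
  have hu0 : 0 ≤ u := hu' ▸ Finset.sum_nonneg fun _ _ => sq_nonneg _
  have hw0 : 0 ≤ w := hw' ▸ Finset.sum_nonneg fun _ _ => sq_nonneg _
  have hcs : ∑ i, p i * s i - 1 / d ≤ √u * √w := by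
    rw [← hexp p s hp hs, ← hu', ← hw']
    exact Real.sum_mul_le_sqrt_mul_sqrt _ _ _
  -- Cauchy–Schwarz in the plane for `(√u, √(1 - t))` and `(√w, √(1 - ∑ sᵢ²))`; the squared length
  -- of the second is `1 - 1/d`, free of `s`.
  have h1 : √u * √w + √(1 - t) * √(1 - ∑ i, s i ^ 2) ≤
      √(1 - 1 / d) * √(1 - 1 / d - (t - ∑ i, p i ^ 2)) := by
    have e1 : 1 - 1 / (d : ℝ) = w + (1 - ∑ i, s i ^ 2) := by rw [hw]; ring
    have e2 : 1 - 1 / (d : ℝ) - (t - ∑ i, p i ^ 2) = u + (1 - t) := by rw [hu]; ring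
    rw [e2, e1, mul_comm √(w + _),
      ← Real.sqrt_mul (show 0 ≤ u + (1 - t) by linarith)]
    apply Real.le_sqrt_of_sq_le
    have a1 := Real.sq_sqrt hu0
    have a2 := Real.sq_sqrt hw0
    have a3 := Real.sq_sqrt (sub_nonneg.mpr ht)
    have a4 := Real.sq_sqrt (sub_nonneg.mpr hs1)
    have : (u + (1 - t)) * (w + (1 - ∑ i, s i ^ 2)) =
        (√u ^ 2 + √(1 - t) ^ 2) * (√w ^ 2 + √(1 - ∑ i, s i ^ 2) ^ 2) := by
      rw [a1, a2, a3, a4]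
    rw [this]
    nlinarith [sq_nonneg (√u * √(1 - ∑ i, s i ^ 2) - √(1 - t) * √w)]
  linarith

end

end CoherenceEstimation

/-! ### The bound on the geometric coherence -/

open CoherenceEstimation in
theorem mainTheorem1 (n d : ℕ) (hn : 0 < n) (hd : d = 2 ^ n)
    (ρ : Matrix (Fin d) (Fin d) ℂ) (hρ : CoherenceEstimation.IsState ρ)
    (ψ : OrthonormalBasis (Fin d) ℂ (EuclideanSpace ℂ (Fin d)))
    (X : Set (Fin d → ℝ)) (hX : X ⊆ stdSimplex ℝ (Fin d))
    (hp : CoherenceEstimation.measDist ψ ρ ∈ X) :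
    0 ≤ 1 - (d : ℝ) / ((d : ℝ) - 1) * CoherenceEstimation.l2Estimate ρ X ∧
      CoherenceEstimation.geometricCoherence ρ ≥
        ((d : ℝ) - 1) / (d : ℝ) *
          (1 - √(1 - (d : ℝ) / ((d : ℝ) - 1) * CoherenceEstimation.l2Estimate ρ X)) := by
  -- The form `2 ^ n` matters only through `d ≥ 2`, which makes `d - 1` positive.
  have hd2 : 2 ≤ d := hd ▸ Nat.le_self_pow hn.ne' 2
  have hd0 : (0 : ℝ) < d := by positivity
  have hd1 : (0 : ℝ) < (d : ℝ) - 1 := by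
    have : (2 : ℝ) ≤ d := by exact_mod_cast hd2
    linarith
  have hl := l2Estimate_le hρ ψ hX hp
  have hdiag := hρ.diagDist_mem_stdSimplex
  have ht := hρ.trace_mul_self_le_one
  -- With `tr ρ² ≤ 1` this yields `l2Estimate ρ X ≤ 1 - 1/d`, the nonnegativity claim.
  have ha : 1 / (d : ℝ) ≤ ∑ i, diagDist ρ i ^ 2 := by
    have := sq_sum_le_card_mul_sum_sq (s := Finset.univ) (f := diagDist ρ)
    rw [hdiag.2] at this
    rw [div_le_iff₀' hd0]
    simpa using this
  have hc : 1 - 1 / (d : ℝ) = ((d : ℝ) - 1) / d := by field_simp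
  have hfac : 1 - (d : ℝ) / ((d : ℝ) - 1) * l2Estimate ρ X =
      d / ((d : ℝ) - 1) * (1 - 1 / d - l2Estimate ρ X) := by
    rw [hc]; field_simp
  refine ⟨?_, ?_⟩
  · rw [hfac]
    exact mul_nonneg (by positivity) (by linarith)
  -- Since the maximum is attained, it is enough to bound the fidelity with one optimal `σ`.
  · obtain ⟨σ, hσ, hF⟩ := (isGreatest_fidelity (by omega) ρ).1
    have hσd := hσ.1.diagDist_mem_stdSimplex
    have h1 := fidelity_le_superfidelity hρ hσ.1
    rw [trace_mul_diag_re hσ, trace_mul_diag_re hσ] at h1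
    simp only [← sq (diagDist σ _)] at h1
    have h2 := sum_mul_add_sqrt_mul_sqrt_le (by omega) hdiag.2 hσd.2 ht
      (sum_sq_le_one_of_mem_stdSimplex hσd)
    have h3 : √(1 - 1 / (d : ℝ)) * √(1 - 1 / d - ((ρ * ρ).trace.re - ∑ i, diagDist ρ i ^ 2)) ≤
        √(1 - 1 / (d : ℝ)) * √(1 - 1 / d - l2Estimate ρ X) := by
      gcongr
    have h4 : √(1 - 1 / (d : ℝ)) * √(1 - 1 / d - l2Estimate ρ X) =
        ((d : ℝ) - 1) / d * √(1 - d / ((d : ℝ) - 1) * l2Estimate ρ X) := by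
      rw [hfac, ← Real.sqrt_mul (by rw [hc]; positivity)]
      have : (1 - 1 / (d : ℝ)) * (1 - 1 / d - l2Estimate ρ X) =
          (((d : ℝ) - 1) / d) ^ 2 * (d / ((d : ℝ) - 1) * (1 - 1 / d - l2Estimate ρ X)) := by
        rw [hc]; field_simp
      rw [this, Real.sqrt_mul (sq_nonneg _), Real.sqrt_sq (by positivity)]
    rw [ge_iff_le, mul_sub, ← h4, mul_one, ← hc]
    linarith
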